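/- Let $(M,d)$ be a metric space with a Borel measure $\mu$ such that $\mu(M)>0$ and every ball has finite measure; write $B_r(x)$ for the open ball with centre $x$ and radius $r$. Assume: - (local doubling) for every $s>0$ there is a constant $D_s$ such that $\mu(B_{2r}(x))\le D_s\,\mu(B_r(x))$ for all $x\in M$ and $0<r\le s$; - (approximate midpoints) there are $R_0\in[0,\infty)$ and $\beta\in[1/2,1)$ such that for all $x,y\in M$ with $d(x,y)>R_0$ there is $z\in M$ with $d(x,z)<\beta\,d(x,y)$ and $d(y,z)<\beta\,d(x,y)$. Functions take values in $\mathbb K=\mathbb R$ or $\mathbb K=\mathbb C$. For $q\in[1,\infty)$, $b>0$ and a locally integrable function $f$ on $M$ put, for $x\in M$, $$f^{\sharp,q}_b(x)=\sup_{0<r\le b}\Bigl(\frac1{\mu(B_r(x))}\int_{B_r(x)}|f-f_{B_r(x)}|^q\,d\mu\Bigr)^{1/q},\qquad f_B=\frac1{\mu(B)}\int_B f\,d\mu,$$ $$N^q_b(f)(x)=f^{\sharp,q}_b(x)+\Bigl(\frac1{\mu(B_b(x))}\int_{B_b(x)}|f|^q\,d\mu\Bigr)^{1/q}.$$ If $f$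 is not $q$-integrable on $B_b(x)$, set $N^q_b(f)(x)=\infty$. Let $\mathfrak{bmo}^q_b(M)$ be the space of all locally integrable $f$ with $N^q_b(f)\in L^\infty(M)$, with norm $\|f\|_{\mathfrak{bmo}^q_b}=\|N^q_b(f)\|_\infty$. Then: 1. for all $q\in[1,\infty)$ and $b>c>0$, the spaces $\mathfrak{bmo}^q_b(M)$ and $\mathfrak{bmo}^q_c(M)$ coincide and their norms are equivalent; 2. for all $q\in[1,\infty)$, the spaces $\mathfrak{bmo}^q_1(M)$ and $\mathfrak{bmo}^1_1(M)$ coincide and their norms are equivalent; 3. consequently, for all $p,q\in[1,\infty)$ and $b,c>0$, the spaces $\mathfrak{bmo}^q_b(M)$ and $\mathfrak{bmo}^p_c(M)$ coincide and their norms are equivalent. -/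

import Mathlib

open MeasureTheory Metric
open scoped ENNReal NNReal

/-- Local doubling property (LDP): for every `s > 0` there is a constant `D` with
`μ (2B) ≤ D μ (B)` for all balls `B` of radius at most `s`. -/
def LocalDoublingProperty {M : Type*} [MetricSpace M] [MeasurableSpace M]
    (μ : Measure M) : Prop :=
  ∀ s : ℝ, 0 < s → ∃ D : ℝ≥0, ∀ (x : M) (r : ℝ), 0 < r → r ≤ s →
    μ (ball x (2 * r)) ≤ D * μ (ball x r)

/-- Approximate midpoint property (AMP).  Every space in which any two points have a midpoint
satisfies it, with `R₀ = 0` and any `β` in `(1/2, 1)`. -/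
def ApproximateMidpointProperty (M : Type*) [MetricSpace M] : Prop :=
  ∃ R₀ β : ℝ, 0 ≤ R₀ ∧ 1 / 2 ≤ β ∧ β < 1 ∧ ∀ x y : M, R₀ < dist x y →
    ∃ z : M, dist x z < β * dist x y ∧ dist y z < β * dist x y

section Bmo

variable {M 𝕜 : Type*} [MetricSpace M] [MeasurableSpace M] [RCLike 𝕜]

/-- The local sharp maximal function: the supremum, over all balls `B` centred at `x` with radius
at most `b`, of the `L^q` mean oscillation of `f` on `B`, as a value in `[0, ∞]`. -/
noncomputable def localSharp (μ : Measure M) (q b : ℝ) (f : M → 𝕜) (x : M) : ℝ≥0∞ :=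
  ⨆ r ∈ Set.Ioc (0 : ℝ) b,
    (⨍⁻ y in ball x r, ‖f y - ⨍ z in ball x r, f z ∂μ‖ₑ ^ q ∂μ) ^ (1 / q)

/-- The modified local sharp maximal function `N^q_b f`, with values in `[0, ∞]`. -/
noncomputable def modifiedLocalSharp (μ : Measure M) (q b : ℝ) (f : M → 𝕜) (x : M) : ℝ≥0∞ :=
  localSharp μ q b f x + (⨍⁻ y in ball x b, ‖f y‖ₑ ^ q ∂μ) ^ (1 / q)

/-- The norm `‖f‖ = ‖N^q_b f‖_∞` (an essential supremum), as a value in `[0, ∞]`. -/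
noncomputable def gbmoNorm (μ : Measure M) (q b : ℝ) (f : M → 𝕜) : ℝ≥0∞ :=
  essSup (modifiedLocalSharp μ q b f) μ

/-- The space `𝔟𝔪𝔬^q_b(M)` of all locally integrable `f : M → 𝕜` with `N^q_b f` in `L^∞`.
Where `N^q_b f` is finite, `f` is `q`-integrable on the ball `B_b(x)`, so all the averages
of `f` that occur are honest integrals. -/
def gbmo (𝕜 : Type*) [RCLike 𝕜] (μ : Measure M) (q b : ℝ) : Set (M → 𝕜) :=
  {f | LocallyIntegrable f μ ∧ gbmoNorm μ q b f < ∞}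

/-- The spaces `𝔟𝔪𝔬^q_b(M)` and `𝔟𝔪𝔬^p_c(M)` coincide and their norms are equivalent. -/
def GbmoCoincide (𝕜 : Type*) [RCLike 𝕜] (μ : Measure M) (q b p c : ℝ) : Prop :=
  gbmo 𝕜 μ q b = gbmo 𝕜 μ p c ∧
    ∃ C₁ C₂ : ℝ≥0, 0 < C₁ ∧ 0 < C₂ ∧ ∀ f ∈ gbmo 𝕜 μ q b,
      C₁ * gbmoNorm μ q b f ≤ gbmoNorm μ p c f ∧
        gbmoNorm μ p c f ≤ C₂ * gbmoNorm μ q b f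

end Bmo

open Filter Topology

/-! ### Doubling at all scales, coverings, and averages with almost every centre. -/

section Doubling

variable {M : Type*} [MetricSpace M] [MeasurableSpace M] {μ : Measure M}

/-! All norms are compared with the one for exponent $1$ and radius $1$, by inequalities in
$[0,\infty]$ valid for every locally integrable function; these identify spaces and norms at once.

Change of radius (`gbmoNormLE_radius`): on a ball of radius between $c$ and $b$ the oscillation is
at most twice the $L^q$ average of $f$. A Vitali covering by balls of radius $c$
(`exists_setLIntegral_ball_le`) bounds that average, up to doubling constants.

Change of exponent: one direction is Jensen. The other is John–Nirenberg (`exists_john_nirenberg`):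
a stopping-radius argument, with Vitali balls in place of dyadic cubes, halves the measure of the
set of large deviation at each further level $Ka$. Exponential decay then bounds every moment
(`setLIntegral_rpow_le_of_distribution`). The selected balls leave $B_r(x)$ but stay in $B_{2r}(x)$,
so oscillations on larger balls are needed; the change of radius supplies them. -/

theorem LocalDoublingProperty.exists_ball_mul_le (hD : LocalDoublingProperty μ) {s : ℝ}
    (hs : 0 < s) (k : ℝ) :
    ∃ D : ℝ≥0, 1 ≤ D ∧ ∀ (x : M) (r : ℝ), 0 < r → r ≤ s →
      μ (ball x (k * r)) ≤ D * μ (ball x r) := by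
  have pow : ∀ n : ℕ, ∃ D : ℝ≥0, 1 ≤ D ∧ ∀ (x : M) (r : ℝ), 0 < r → r ≤ s →
      μ (ball x (2 ^ n * r)) ≤ D * μ (ball x r) := by
    intro n
    induction n with
    | zero => exact ⟨1, le_rfl, fun x r _ _ => by simp⟩
    | succ n ih =>
      obtain ⟨D, hD1, h⟩ := ih
      -- The doubling constant depends on the scale, so each doubling invokes the hypothesis at a
      -- new one.
      obtain ⟨D', h'⟩ := hD (2 ^ n * s) (by positivity)
      refine ⟨max 1 D' * D, one_le_mul_of_one_le_of_one_le (le_max_left _ _) hD1,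
        fun x r hr hrs => ?_⟩
      calc μ (ball x (2 ^ (n + 1) * r)) = μ (ball x (2 * (2 ^ n * r))) := by
            congr 2; ring
        _ ≤ D' * μ (ball x (2 ^ n * r)) := h' x _ (by positivity) (by gcongr)
        _ ≤ (max 1 D' : ℝ≥0) * (D * μ (ball x r)) := by
            gcongr
            · exact le_max_right _ _
            · exact h x r hr hrs
        _ = _ := by push_cast; ring
  obtain ⟨n, hn⟩ := pow_unbounded_of_one_lt k (one_lt_two : (1 : ℝ) < 2)
  obtain ⟨D, hD1, h⟩ := pow n
  exact ⟨D, hD1, fun x r hr hrs =>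
    (measure_mono (ball_subset_ball (by gcongr))).trans (h x r hr hrs)⟩

/-- A null ball would, by doubling, make all concentric balls null, and these exhaust `M`. -/
theorem LocalDoublingProperty.measure_ball_pos (hD : LocalDoublingProperty μ)
    (hpos : 0 < μ Set.univ) (x : M) {r : ℝ} (hr : 0 < r) : 0 < μ (ball x r) := by
  refine pos_iff_ne_zero.2 fun h0 => hpos.ne' ?_
  rw [← iUnion_ball_nat x]
  refine measure_iUnion_null fun n => ?_
  obtain ⟨D, -, h⟩ := hD.exists_ball_mul_le hr (n / r)
  have := h x r hr le_rfl
  rwa [h0, mul_zero, div_mul_cancel₀ _ hr.ne', nonpos_iff_eq_zero] at this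

theorem sigmaFinite_of_measure_ball_lt_top (hfin : ∀ (x : M) (r : ℝ), μ (ball x r) < ∞) :
    SigmaFinite μ := by
  rcases isEmpty_or_nonempty M with h | ⟨⟨x⟩⟩
  · rw [Measure.eq_zero_of_isEmpty μ]; infer_instance
  · exact ⟨⟨⟨fun n : ℕ => ball x n, fun _ => trivial, fun n => hfin x n, iUnion_ball_nat x⟩⟩⟩

/-- The Vitali covering lemma for balls, one at each point of a set; the measure makes the
disjoint subfamily countable. -/
theorem exists_countable_disjoint_ball_cover [OpensMeasurableSpace M] [SigmaFinite μ]
    (hpos : ∀ (x : M) (r : ℝ), 0 < r → 0 < μ (ball x r))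
    (S : Set M) (ρ : M → ℝ) (R : ℝ) (hρ : ∀ x ∈ S, 0 < ρ x) (hR : ∀ x ∈ S, ρ x ≤ R) :
    ∃ u ⊆ S, u.Countable ∧ u.PairwiseDisjoint (fun z => ball z (ρ z)) ∧
      S ⊆ ⋃ z ∈ u, ball z (5 * ρ z) := by
  obtain ⟨u, huS, hdisj, hcov⟩ := Vitali.exists_disjoint_subfamily_covering_enlargement_ball
    S id ρ R hR 5 (by norm_num)
  refine ⟨u, huS, ?_, hdisj, fun x hx => ?_⟩
  · have := Measure.countable_meas_pos_of_disjoint_iUnion (μ := μ)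
      (As := fun z : u => ball (z : M) (ρ z)) (fun _ => measurableSet_ball)
      (fun a b hab => hdisj a.2 b.2 (by simpa [Subtype.ext_iff] using hab))
    have huniv : {z : u | 0 < μ (ball (z : M) (ρ z))} = Set.univ :=
      Set.eq_univ_of_forall fun z => hpos _ _ (hρ z (huS z.2))
    rw [huniv, Set.countable_univ_iff] at this
    exact Set.countable_coe_iff.1 this
  · obtain ⟨z, hz, hsub⟩ := hcov x hx
    exact Set.mem_iUnion₂.2 ⟨z, hz, hsub (mem_ball_self (hρ x hx))⟩

theorem secondCountableTopology_of_measure_ball_pos [OpensMeasurableSpace M] [SigmaFinite μ]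
    (hpos : ∀ (x : M) (r : ℝ), 0 < r → 0 < μ (ball x r)) : SecondCountableTopology M := by
  refine Metric.secondCountable_of_almost_dense_set fun ε hε => ?_
  obtain ⟨u, -, hu, -, hcov⟩ := exists_countable_disjoint_ball_cover hpos Set.univ
    (fun _ => ε / 5) (ε / 5) (fun _ _ => by positivity) (fun _ _ => le_rfl)
  refine ⟨u, hu, fun x => ?_⟩
  obtain ⟨z, hz, hxz⟩ := Set.mem_iUnion₂.1 (hcov (Set.mem_univ x))
  exact ⟨z, hz, by rw [mem_ball] at hxz; linarith⟩

theorem LocalDoublingProperty.isUnifLocDoublingMeasure (hD : LocalDoublingProperty μ) :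
    IsUnifLocDoublingMeasure μ := by
  obtain ⟨D, -, h⟩ := hD.exists_ball_mul_le one_pos 3
  refine ⟨⟨D, ?_⟩⟩
  filter_upwards [Ioc_mem_nhdsGT (one_pos : (0 : ℝ) < 1)] with r hr x
  calc μ (closedBall x (2 * r)) ≤ μ (ball x (3 * r)) :=
        measure_mono (closedBall_subset_ball (by linarith [hr.1]))
    _ ≤ D * μ (ball x r) := h x r hr.1 hr.2
    _ ≤ D * μ (closedBall x r) := by gcongr; exact ball_subset_closedBall

/-- If averages of `g` over balls of a fixed radius with almost every centre are bounded by `a`,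
then averages over balls of comparable radius with arbitrary centre are bounded by a multiple
of `a`. -/
theorem LocalDoublingProperty.exists_setLIntegral_ball_le [OpensMeasurableSpace M]
    [SigmaFinite μ] (hD : LocalDoublingProperty μ)
    (hpos : ∀ (x : M) (r : ℝ), 0 < r → 0 < μ (ball x r)) {m b c : ℝ} (hm : 0 < m) (hc : 0 < c) :
    ∃ C : ℝ≥0, 1 ≤ C ∧ ∀ (g : M → ℝ≥0∞) (a : ℝ≥0∞),
      (∀ᵐ x ∂μ, ∫⁻ y in ball x c, g y ∂μ ≤ a * μ (ball x c)) →
      ∀ (x : M) (r : ℝ), m ≤ r → r ≤ b →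
        ∫⁻ y in ball x r, g y ∂μ ≤ C * a * μ (ball x r) := by
  obtain ⟨D₁, hD₁, h₁⟩ := hD.exists_ball_mul_le (by positivity : 0 < c / 5) 5
  obtain ⟨D₂, hD₂, h₂⟩ := hD.exists_ball_mul_le hm ((b + c) / m)
  refine ⟨D₁ * D₂, one_le_mul_of_one_le_of_one_le hD₁ hD₂, fun g a hg x r hmr hrb => ?_⟩
  set G := {x | ∫⁻ y in ball x c, g y ∂μ ≤ a * μ (ball x c)} with hG
  -- Disjoint balls of radius `c / 5` enlarge to balls of radius `c` with good centres; the bad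
  -- points form a null set and need not be covered.
  obtain ⟨u, huS, hu, hdisj, hcov⟩ := exists_countable_disjoint_ball_cover hpos (G ∩ ball x r)
    (fun _ => c / 5) (c / 5) (fun _ _ => by positivity) (fun _ _ => le_rfl)
  have := hu.to_subtype
  have hae : (ball x r : Set M) ≤ᵐ[μ] ⋃ z ∈ u, ball z c := by
    filter_upwards [hg] with y hy hyr
    have := hcov ⟨hy, hyr⟩
    rwa [mul_div_cancel₀ c (by norm_num : (5 : ℝ) ≠ 0)] at this
  calc ∫⁻ y in ball x r, g y ∂μ ≤ ∫⁻ y in ⋃ z ∈ u, ball z c, g y ∂μ :=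
        lintegral_mono' (Measure.restrict_mono_ae hae) le_rfl
    _ ≤ ∑' z : u, ∫⁻ y in ball (z : M) c, g y ∂μ := by
        rw [Set.biUnion_eq_iUnion]; exact lintegral_iUnion_le _ _
    _ ≤ ∑' z : u, a * (D₁ * μ (ball (z : M) (c / 5))) := by
        refine ENNReal.tsum_le_tsum fun z => (huS z.2).1.trans ?_
        gcongr
        have := h₁ z (c / 5) (by positivity) le_rfl
        rwa [mul_div_cancel₀ c (by norm_num : (5 : ℝ) ≠ 0)] at this
    _ = a * D₁ * μ (⋃ z ∈ u, ball z (c / 5)) := by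
        rw [measure_biUnion hu hdisj fun _ _ => measurableSet_ball, ← ENNReal.tsum_mul_left]
        simp_rw [mul_assoc]
    _ ≤ a * D₁ * μ (ball x ((b + c) / m * m)) := by
        gcongr
        refine Set.iUnion₂_subset fun z hz => ball_subset_ball' ?_
        have := (huS hz).2
        rw [mem_ball] at this
        rw [div_mul_cancel₀ _ hm.ne']
        linarith
    _ ≤ a * D₁ * (D₂ * μ (ball x m)) := by gcongr; exact h₂ x m hm le_rfl
    _ ≤ a * D₁ * (D₂ * μ (ball x r)) := by gcongr
    _ = _ := by push_cast; ring

end Doubling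

/-! ### Mean oscillation, and moments from the distribution function. -/

section Averages

variable {α 𝕜 : Type*} [MeasurableSpace α] [RCLike 𝕜] {μ : Measure α}

theorem isProbabilityMeasure_normalized_restrict {s : Set α} (h0 : μ s ≠ 0) (htop : μ s ≠ ∞) :
    IsProbabilityMeasure ((μ.restrict s Set.univ)⁻¹ • μ.restrict s) :=
  ⟨by simp [ENNReal.inv_mul_cancel h0 htop]⟩

theorem enorm_setAverage_sub_le {s : Set α} (h0 : μ s ≠ 0) (htop : μ s ≠ ∞) {f : α → 𝕜}
    (hf : IntegrableOn f s μ) {c : 𝕜} {A : ℝ≥0∞} (h : ∫⁻ y in s, ‖f y - c‖ₑ ∂μ ≤ A * μ s) :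
    ‖(⨍ y in s, f y ∂μ) - c‖ₑ ≤ A := by
  have := isProbabilityMeasure_normalized_restrict h0 htop
  have hint : Integrable f ((μ.restrict s Set.univ)⁻¹ • μ.restrict s) :=
    hf.smul_measure (by simpa using h0)
  have hsub : (⨍ y in s, f y ∂μ) - c = ⨍ y in s, (f y - c) ∂μ := by
    rw [average, average, integral_sub hint (integrable_const c), integral_const, probReal_univ,
      one_smul]
  rw [hsub, average]
  refine (enorm_integral_le_lintegral_enorm _).trans ?_
  rw [← laverage, setLAverage_eq]
  exact (ENNReal.div_le_iff h0 htop).2 h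

/-- The mean oscillation is at most twice the mean distance to any constant. -/
theorem setLIntegral_sub_setAverage_le {s : Set α} (h0 : μ s ≠ 0) (htop : μ s ≠ ∞) {f : α → 𝕜}
    (hf : IntegrableOn f s μ) {c : 𝕜} {A : ℝ≥0∞} (h : ∫⁻ y in s, ‖f y - c‖ₑ ∂μ ≤ A * μ s) :
    ∫⁻ y in s, ‖f y - ⨍ z in s, f z ∂μ‖ₑ ∂μ ≤ 2 * A * μ s := by
  set k := ⨍ z in s, f z ∂μ
  calc ∫⁻ y in s, ‖f y - k‖ₑ ∂μ ≤ ∫⁻ y in s, (‖f y - c‖ₑ + ‖k - c‖ₑ) ∂μ := by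
        refine lintegral_mono fun y => ?_
        rw [← sub_sub_sub_cancel_right (f y) k c]
        exact enorm_sub_le
    _ = ∫⁻ y in s, ‖f y - c‖ₑ ∂μ + ‖k - c‖ₑ * μ s := by
        rw [lintegral_add_right _ measurable_const, setLIntegral_const]
    _ ≤ A * μ s + A * μ s := by
        gcongr
        exact enorm_setAverage_sub_le h0 htop hf h
    _ = _ := by ring

/-- Geometric decay beats polynomial growth. The sum is the constant in the moment bound below. -/
theorem tsum_rpow_mul_half_pow_ne_top (K : ℝ≥0) {q : ℝ} (hq : 0 ≤ q) :
    ∑' n : ℕ, (((n + 1 : ℕ) : ℝ≥0∞) * K) ^ q * (1 / 2) ^ n ≠ ∞ := by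
  have hs : Summable fun n : ℕ => ((n + 1 : ℕ) : ℝ≥0) ^ ⌈q⌉₊ * (1 / 2) ^ (n + 1) := by
    have := summable_pow_mul_geometric_of_norm_lt_one (R := ℝ) ⌈q⌉₊ (r := 1 / 2) (by norm_num)
    rw [← NNReal.summable_coe]
    push_cast
    simpa using (summable_nat_add_iff 1).2 this
  refine ne_top_of_le_ne_top (b := (2 * (K : ℝ≥0∞) ^ q) *
    ∑' n : ℕ, ((((n + 1 : ℕ) : ℝ≥0) ^ ⌈q⌉₊ * (1 / 2) ^ (n + 1) : ℝ≥0) : ℝ≥0∞))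
    (ENNReal.mul_ne_top (by finiteness) (ENNReal.tsum_coe_ne_top_iff_summable.2 hs)) ?_
  rw [← ENNReal.tsum_mul_left]
  refine ENNReal.tsum_le_tsum fun n => ?_
  rw [ENNReal.mul_rpow_of_nonneg _ _ hq]
  calc ((n + 1 : ℕ) : ℝ≥0∞) ^ q * (K : ℝ≥0∞) ^ q * (1 / 2) ^ n
      ≤ ((n + 1 : ℕ) : ℝ≥0∞) ^ (⌈q⌉₊ : ℝ) * (K : ℝ≥0∞) ^ q * (1 / 2) ^ n := by
        gcongr
        · simp
        · exact Nat.le_ceil q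
    _ = 2 * 2⁻¹ * (((n + 1 : ℕ) : ℝ≥0∞) ^ ⌈q⌉₊ * (K : ℝ≥0∞) ^ q * (1 / 2) ^ n) := by
        rw [ENNReal.mul_inv_cancel two_ne_zero ENNReal.ofNat_ne_top, one_mul,
          ENNReal.rpow_natCast]
    _ = _ := by
        have h2 : (((1 / 2 : ℝ≥0)) : ℝ≥0∞) = 2⁻¹ := by simp
        push_cast [h2]
        rw [pow_succ, one_div]; ring

/-- Exponential decay of the distribution function bounds the `q`-th moment. -/
theorem setLIntegral_rpow_le_of_distribution {s : Set α} {g : α → ℝ≥0∞}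
    (hg : AEMeasurable g (μ.restrict s)) (hgtop : ∀ y, g y ≠ ∞) {K a : ℝ≥0} (hK : 0 < K)
    (ha : 0 < a) {q : ℝ} (hq : 0 < q)
    (h : ∀ n : ℕ, μ (s ∩ {y | (n : ℝ≥0∞) * (K * a) < g y}) ≤ (1 / 2) ^ n * μ s) :
    ∫⁻ y in s, g y ^ q ∂μ ≤
      (∑' n : ℕ, (((n + 1 : ℕ) : ℝ≥0∞) * K) ^ q * (1 / 2) ^ n) * (a : ℝ≥0∞) ^ q * μ s := by
  have hE : ∀ n : ℕ, NullMeasurableSet {y | (n : ℝ≥0∞) * (K * a) < g y} (μ.restrict s) :=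
    fun n => nullMeasurableSet_lt aemeasurable_const hg
  calc ∫⁻ y in s, g y ^ q ∂μ
      ≤ ∫⁻ y in s, ∑' n : ℕ, {y | (n : ℝ≥0∞) * (K * a) < g y}.indicator
          (fun _ => (((n + 1 : ℕ) : ℝ≥0∞) * (K * a)) ^ q) y ∂μ := by
        refine lintegral_mono fun y => ?_
        rcases eq_or_ne (g y) 0 with h0 | h0
        · simp [h0, hq]
        classical
        have hex : ∃ n : ℕ, g y ≤ n * (K * a) := by
          have hKa : (K * a : ℝ≥0∞) ≠ 0 := by positivity
          obtain ⟨n, hn⟩ := ENNReal.exists_nat_mul_gt hKa (hgtop y)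
          exact ⟨n, hn.le⟩
        -- At the level `m` with $mKa < g(y) \le (m+1)Ka$, one term of the series already dominates.
        obtain ⟨m, hm⟩ : ∃ m, Nat.find hex = m + 1 := by
          refine Nat.exists_eq_succ_of_ne_zero fun hz => h0 ?_
          have := Nat.find_spec hex
          rw [hz] at this
          simpa using this
        have h1 := Nat.find_spec hex
        rw [hm] at h1
        have h2 := not_le.1 (Nat.find_min hex (m := m) (by omega))
        refine le_trans ?_ (ENNReal.le_tsum m)
        rw [Set.indicator_of_mem (by exact h2)]
        gcongr
    _ = ∑' n : ℕ, (((n + 1 : ℕ) : ℝ≥0∞) * (K * a)) ^ q *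
          μ.restrict s {y | (n : ℝ≥0∞) * (K * a) < g y} := by
        rw [lintegral_tsum fun n => aemeasurable_const.indicator₀ (hE n)]
        simp_rw [lintegral_indicator_const₀ (hE _)]
    _ ≤ ∑' n : ℕ, ((((n + 1 : ℕ) : ℝ≥0∞) * K) ^ q * (1 / 2) ^ n) *
          ((a : ℝ≥0∞) ^ q * μ s) := by
        refine ENNReal.tsum_le_tsum fun n => ?_
        have h1 : μ.restrict s {y | (n : ℝ≥0∞) * (K * a) < g y} ≤ (1 / 2) ^ n * μ s := by
          rw [Measure.restrict_apply₀ (hE n), Set.inter_comm]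
          exact h n
        calc _ ≤ (((n + 1 : ℕ) : ℝ≥0∞) * (K * a)) ^ q * ((1 / 2) ^ n * μ s) := by gcongr
          _ = _ := by
            rw [← mul_assoc ((n + 1 : ℕ) : ℝ≥0∞), ENNReal.mul_rpow_of_nonneg _ _ hq.le]
            ring
    _ = _ := by rw [ENNReal.tsum_mul_right, mul_assoc]

end Averages

/-! ### Lebesgue differentiation and the John–Nirenberg inequality. -/

section JohnNirenberg

variable {M 𝕜 : Type*} [MetricSpace M] [MeasurableSpace M] [RCLike 𝕜] {μ : Measure M}

theorem locallyIntegrable_of_integrableOn_ball {f : M → 𝕜}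
    (hf : ∀ (x : M) (r : ℝ), IntegrableOn f (ball x r) μ) : LocallyIntegrable f μ :=
  fun x => ⟨ball x 1, ball_mem_nhds x one_pos, hf x 1⟩

/-- At almost every point, `f` is as close to `c` as the averages of `‖f - c‖` over small balls
are, up to a doubling constant. -/
theorem ae_enorm_sub_le_of_forall_ball [BorelSpace M] [SecondCountableTopology M]
    [IsLocallyFiniteMeasure μ] [IsUnifLocDoublingMeasure μ] {D : ℝ≥0}
    (hpos : ∀ (x : M) (r : ℝ), 0 < r → 0 < μ (ball x r))
    (hfin : ∀ (x : M) (r : ℝ), μ (ball x r) < ∞)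
    (hD : ∀ (x : M) (r : ℝ), 0 < r → r ≤ 1 → μ (ball x (2 * r)) ≤ D * μ (ball x r))
    {f : M → 𝕜} (hf : ∀ (x : M) (r : ℝ), IntegrableOn f (ball x r) μ) :
    ∀ᵐ y ∂μ, ∀ (c : 𝕜) (R : ℝ) (A : ℝ≥0∞), 0 < R → R ≤ 1 →
      (∀ k : ℕ, ∫⁻ z in ball y (R * (1 / 5) ^ k), ‖f z - c‖ₑ ∂μ
        ≤ A * μ (ball y (R * (1 / 5) ^ k))) → ‖f y - c‖ₑ ≤ D * A := by
  filter_upwards [IsUnifLocDoublingMeasure.ae_tendsto_average μ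
    (locallyIntegrable_of_integrableOn_ball hf) 1] with y hy c R A hR hR1 hA
  have hpow : ∀ k : ℕ, 0 < R * (1 / 5 : ℝ) ^ k := fun k => by positivity
  -- Halving the radii puts the closed balls of the differentiation theorem inside the given open
  -- balls; this costs the factor `D`.
  have hlim : Tendsto (fun k : ℕ => R * (1 / 5 : ℝ) ^ k / 2) atTop (𝓝[>] 0) := by
    refine tendsto_nhdsWithin_iff.2 ⟨?_, Eventually.of_forall fun k => half_pos (hpow k)⟩
    have := ((tendsto_pow_atTop_nhds_zero_of_lt_one (by norm_num : (0 : ℝ) ≤ 1 / 5)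
      (by norm_num)).const_mul R).div_const 2
    simpa using this
  have := hy (fun _ => y) _ hlim (Eventually.of_forall fun k =>
    mem_closedBall_self (by linarith [hpow k]))
  refine le_of_tendsto ((this.sub_const c).enorm) (Eventually.of_forall fun k => ?_)
  have hk := hpow k
  have hk1 : R * (1 / 5 : ℝ) ^ k ≤ 1 :=
    mul_le_one₀ hR1 (by positivity) (pow_le_one₀ (by norm_num) (by norm_num))
  have hsub : closedBall y (R * (1 / 5 : ℝ) ^ k / 2) ⊆ ball y (R * (1 / 5 : ℝ) ^ k) :=
    closedBall_subset_ball (by linarith)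
  refine enorm_setAverage_sub_le
    ((hpos y _ (half_pos hk)).trans_le (measure_mono ball_subset_closedBall)).ne'
    ((measure_mono hsub).trans_lt (hfin _ _)).ne ((hf y _).mono_set hsub) ?_
  calc ∫⁻ z in closedBall y (R * (1 / 5 : ℝ) ^ k / 2), ‖f z - c‖ₑ ∂μ
      ≤ ∫⁻ z in ball y (R * (1 / 5) ^ k), ‖f z - c‖ₑ ∂μ := lintegral_mono_set hsub
    _ ≤ A * μ (ball y (R * (1 / 5) ^ k)) := hA k
    _ ≤ A * (D * μ (ball y (R * (1 / 5) ^ k / 2))) := by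
        gcongr
        have := hD y (R * (1 / 5) ^ k / 2) (by positivity) (by linarith)
        rwa [mul_div_cancel₀ _ (two_ne_zero' ℝ)] at this
    _ ≤ A * (D * μ (closedBall y (R * (1 / 5) ^ k / 2))) := by
        gcongr; exact ball_subset_closedBall
    _ = _ := by ring

/-- The **John–Nirenberg inequality** in a locally doubling space. -/
theorem LocalDoublingProperty.exists_john_nirenberg [BorelSpace M] [SecondCountableTopology M]
    [SigmaFinite μ] [IsLocallyFiniteMeasure μ] (hLDP : LocalDoublingProperty μ)
    (hpos : ∀ (x : M) (r : ℝ), 0 < r → 0 < μ (ball x r))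
    (hfin : ∀ (x : M) (r : ℝ), μ (ball x r) < ∞) :
    ∃ K : ℝ≥0, 0 < K ∧ ∀ f : M → 𝕜, (∀ (x : M) (r : ℝ), IntegrableOn f (ball x r) μ) →
      ∀ a : ℝ≥0, 0 < a → (∀ (x : M) (r : ℝ), 0 < r → r ≤ 2 →
        ∫⁻ y in ball x r, ‖f y - ⨍ z in ball x r, f z ∂μ‖ₑ ∂μ ≤ a * μ (ball x r)) →
      ∀ (n : ℕ) (x : M) (r : ℝ), 0 < r → r ≤ 1 →
        μ (ball x r ∩ {y | (n : ℝ≥0∞) * (K * a) < ‖f y - ⨍ z in ball x r, f z ∂μ‖ₑ})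
          ≤ (1 / 2) ^ n * μ (ball x r) := by
  have := hLDP.isUnifLocDoublingMeasure
  obtain ⟨D, hD1, hD⟩ := hLDP.exists_ball_mul_le two_pos 8
  have hDk : ∀ (k : ℝ) (x : M) (r : ℝ), k ≤ 8 → 0 < r → r ≤ 2 →
      μ (ball x (k * r)) ≤ D * μ (ball x r) := fun k x r hk hr hr2 =>
    (measure_mono (ball_subset_ball (by gcongr))).trans (hD x r hr hr2)
  have hD0 : 0 < D := one_pos.trans_le hD1
  refine ⟨2 * D ^ 3 + D, by positivity, fun f hf a ha hosc n => ?_⟩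
  set K : ℝ≥0 := 2 * D ^ 3 + D with hK
  induction n with
  | zero => intro x r _ _; simpa using measure_mono Set.inter_subset_left
  | succ n ih =>
  intro x r hr hr1
  set k₀ := ⨍ z in ball x r, f z ∂μ with hk₀
  -- The selected balls are centred in $B_r(x)$ with radius at most $r$, so the reference mean is
  -- taken over the doubled ball.
  set c := ⨍ z in ball x (2 * r), f z ∂μ with hc
  have h2 : ∫⁻ y in ball x (2 * r), ‖f y - c‖ₑ ∂μ ≤ a * μ (ball x (2 * r)) :=
    hosc x (2 * r) (by positivity) (by linarith)
  have hk₀c : ‖k₀ - c‖ₑ ≤ D * a := by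
    refine enorm_setAverage_sub_le (hpos x r hr).ne' (hfin x r).ne (hf x r) ?_
    calc ∫⁻ y in ball x r, ‖f y - c‖ₑ ∂μ
        ≤ ∫⁻ y in ball x (2 * r), ‖f y - c‖ₑ ∂μ :=
          lintegral_mono_set (ball_subset_ball (by linarith))
      _ ≤ a * (D * μ (ball x r)) := h2.trans (by
          gcongr; exact hDk 2 x r (by norm_num) hr (by linarith))
      _ = _ := by ring
  -- Stopping height: one `D` for enlarging the selected balls, one for $B_{2r}(x)$ against
  -- $B_r(x)$, and `2` for the gain of one half.
  set L : ℝ≥0∞ := 2 * D ^ 2 * a with hL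
  have hKL : (K : ℝ≥0∞) * a = D * L + D * a := by
    rw [hK, hL]; push_cast; ring
  have hDL : (D : ℝ≥0∞) * a ≤ L := by
    have h1 : (1 : ℝ≥0∞) ≤ D := by exact_mod_cast hD1
    calc (D : ℝ≥0∞) * a = 1 * D * 1 * a := by ring
      _ ≤ 2 * D * D * a := by gcongr; exact one_le_two
      _ = L := by rw [hL]; ring
  have hLtop : L ≠ ∞ := by finiteness
  have hL0 : L ≠ 0 := by positivity
  have hLK : L + D * a ≤ K * a := by
    rw [hKL]; gcongr
    have h1 : (1 : ℝ≥0∞) ≤ D := by exact_mod_cast hD1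
    exact le_mul_of_one_le_left zero_le h1
  set E := ball x r ∩ {y | ((n + 1 : ℕ) : ℝ≥0∞) * (K * a) < ‖f y - k₀‖ₑ} with hE
  -- the selected radius of a point of `E`
  have hradius : ∀ᵐ y ∂μ, y ∈ E → ∃ ρ : ℝ, 0 < ρ ∧ 5 * ρ ≤ r ∧
      L * μ (ball y ρ) ≤ ∫⁻ z in ball y ρ, ‖f z - c‖ₑ ∂μ ∧
      ∫⁻ z in ball y (5 * ρ), ‖f z - c‖ₑ ∂μ ≤ L * μ (ball y (5 * ρ)) := by
    filter_upwards [ae_enorm_sub_le_of_forall_ball (D := D) hpos hfin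
      (fun x r hr hr1 => hDk 2 x r (by norm_num) hr (by linarith)) hf] with y hy hyE
    -- If no average exceeded `L`, differentiation would give $|f(y)-k_0| \le DL + Da = Ka$,
    -- contrary to $y \in E$.
    have hex : ∃ k : ℕ, L * μ (ball y (r * (1 / 5) ^ k)) <
        ∫⁻ z in ball y (r * (1 / 5) ^ k), ‖f z - c‖ₑ ∂μ := by
      by_contra! hcon
      have h3 := hy c r L hr hr1 hcon
      have hlt : ((n + 1 : ℕ) : ℝ≥0∞) * (K * a) < ‖f y - k₀‖ₑ := hyE.2
      refine hlt.not_ge ?_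
      calc ‖f y - k₀‖ₑ ≤ ‖f y - c‖ₑ + ‖k₀ - c‖ₑ := by
            rw [← sub_sub_sub_cancel_right (f y) k₀ c]; exact enorm_sub_le
        _ ≤ D * L + D * a := by gcongr
        _ = 1 * (K * a) := by rw [hKL, one_mul]
        _ ≤ _ := by gcongr; simp
    classical
    have hyx : dist y x < r := hyE.1
    -- At radius `r` the average is at most $Da \le L$, so the first radius `ρ` above height `L` has
    -- a predecessor `5ρ ≤ r` not above it.
    obtain ⟨k, hk⟩ : ∃ k, Nat.find hex = k + 1 := by
      refine Nat.exists_eq_succ_of_ne_zero fun h0 => ?_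
      have h4 := Nat.find_spec hex
      rw [h0, pow_zero, mul_one] at h4
      refine h4.not_ge ?_
      calc ∫⁻ z in ball y r, ‖f z - c‖ₑ ∂μ
          ≤ ∫⁻ z in ball x (2 * r), ‖f z - c‖ₑ ∂μ :=
            lintegral_mono_set (ball_subset_ball' (by linarith))
        _ ≤ a * μ (ball x (2 * r)) := h2
        _ ≤ a * μ (ball y (8 * r)) := by
            gcongr
            exact ball_subset_ball' (by rw [dist_comm]; linarith)
        _ ≤ a * (D * μ (ball y r)) := by gcongr; exact hD y r hr (by linarith)
        _ = D * a * μ (ball y r) := by ring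
        _ ≤ L * μ (ball y r) := by gcongr
    have h5 := Nat.find_spec hex
    have h6 := not_lt.1 (Nat.find_min hex (m := k) (by omega))
    rw [hk] at h5
    have h7 : 5 * (r * (1 / 5 : ℝ) ^ (k + 1)) = r * (1 / 5) ^ k := by rw [pow_succ]; ring
    refine ⟨r * (1 / 5) ^ (k + 1), by positivity, ?_, h5.le, by rw [h7]; exact h6⟩
    rw [h7]
    exact mul_le_of_le_one_right hr.le (pow_le_one₀ (by norm_num) (by norm_num))
  set F := {y | y ∈ E ∧ ∃ ρ : ℝ, 0 < ρ ∧ 5 * ρ ≤ r ∧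
      L * μ (ball y ρ) ≤ ∫⁻ z in ball y ρ, ‖f z - c‖ₑ ∂μ ∧
      ∫⁻ z in ball y (5 * ρ), ‖f z - c‖ₑ ∂μ ≤ L * μ (ball y (5 * ρ))} with hF
  have hEF : μ E ≤ μ F := measure_mono_ae (by
    filter_upwards [hradius] with y hy hyE using ⟨hyE, hy hyE⟩)
  have hch : ∀ y, ∃ ρ : ℝ, y ∈ F → 0 < ρ ∧ 5 * ρ ≤ r ∧
      L * μ (ball y ρ) ≤ ∫⁻ z in ball y ρ, ‖f z - c‖ₑ ∂μ ∧
      ∫⁻ z in ball y (5 * ρ), ‖f z - c‖ₑ ∂μ ≤ L * μ (ball y (5 * ρ)) := fun y => by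
    by_cases hy : y ∈ F
    · exact hy.2.imp fun ρ h _ => h
    · exact ⟨0, fun h => absurd h hy⟩
  choose ρ hρ using hch
  obtain ⟨u, huF, hu, hdisj, hcov⟩ := exists_countable_disjoint_ball_cover hpos F ρ r
    (fun y hy => (hρ y hy).1) (fun y hy => by linarith [(hρ y hy).1, (hρ y hy).2.1])
  have := hu.to_subtype
  -- the part of `F` in one enlarged ball
  have hpart : ∀ z : u, μ (F ∩ ball (z : M) (5 * ρ z)) ≤
      (1 / 2) ^ n * μ (ball (z : M) (5 * ρ z)) := by
    intro z
    obtain ⟨h1, h3, -, h4⟩ := hρ z (huF z.2)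
    have h5ρ : 0 < 5 * ρ z := by linarith
    refine (measure_mono ?_).trans (ih z (5 * ρ z) h5ρ (by linarith))
    rintro y ⟨hyF, hyz⟩
    refine ⟨hyz, ?_⟩
    -- Replacing $k_0$ by $k_1$ costs at most $L + Da \le Ka$, exactly one level, so the induction
    -- hypothesis applies on the enlarged ball.
    set k₁ := ⨍ w in ball (z : M) (5 * ρ z), f w ∂μ
    have hk₁ : ‖k₁ - c‖ₑ ≤ L :=
      enorm_setAverage_sub_le (hpos _ _ h5ρ).ne' (hfin _ _).ne (hf _ _) h4
    change (n : ℝ≥0∞) * (K * a) < ‖f y - k₁‖ₑ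
    by_contra! hcon
    have hlt : ((n + 1 : ℕ) : ℝ≥0∞) * (K * a) < ‖f y - k₀‖ₑ := hyF.1.2
    refine hlt.not_ge ?_
    calc ‖f y - k₀‖ₑ = ‖(f y - k₁) + ((k₁ - c) - (k₀ - c))‖ₑ := by congr 1; ring
      _ ≤ ‖f y - k₁‖ₑ + (‖k₁ - c‖ₑ + ‖k₀ - c‖ₑ) :=
          (enorm_add_le _ _).trans (by gcongr; exact enorm_sub_le)
      _ ≤ n * (K * a) + (L + D * a) := by gcongr
      _ ≤ n * (K * a) + K * a := by gcongr
      _ = _ := by push_cast; ring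
  have hsum : ∑' z : u, μ (ball (z : M) (5 * ρ z)) ≤ 1 / 2 * μ (ball x r) := by
    have h8 : L * ∑' z : u, μ (ball (z : M) (5 * ρ z)) ≤ L * (1 / 2 * μ (ball x r)) := by
      calc L * ∑' z : u, μ (ball (z : M) (5 * ρ z))
          ≤ ∑' z : u, D * ∫⁻ y in ball (z : M) (ρ z), ‖f y - c‖ₑ ∂μ := by
            rw [← ENNReal.tsum_mul_left]
            refine ENNReal.tsum_le_tsum fun z => ?_
            obtain ⟨h1, h3, h4, -⟩ := hρ z (huF z.2)
            calc L * μ (ball (z : M) (5 * ρ z)) ≤ L * (D * μ (ball (z : M) (ρ z))) := by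
                  gcongr; exact hDk 5 z (ρ z) (by norm_num) h1 (by linarith)
              _ = D * (L * μ (ball (z : M) (ρ z))) := by ring
              _ ≤ _ := by gcongr
        _ = D * ∫⁻ y in ⋃ z ∈ u, ball z (ρ z), ‖f y - c‖ₑ ∂μ := by
            rw [lintegral_biUnion hu (fun _ _ => measurableSet_ball) hdisj,
              ENNReal.tsum_mul_left]
        _ ≤ D * ∫⁻ y in ball x (2 * r), ‖f y - c‖ₑ ∂μ := by
            gcongr
            refine Set.iUnion₂_subset fun z hz => ball_subset_ball' ?_
            have h1 : dist z x < r := (huF hz).1.1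
            linarith [(hρ z (huF hz)).1, (hρ z (huF hz)).2.1]
        _ ≤ D * (a * (D * μ (ball x r))) := by
            gcongr
            exact h2.trans (by gcongr; exact hDk 2 x r (by norm_num) hr (by linarith))
        _ = 2 * 2⁻¹ * (D * (a * (D * μ (ball x r)))) := by
            rw [ENNReal.mul_inv_cancel two_ne_zero ENNReal.ofNat_ne_top, one_mul]
        _ = L * (1 / 2 * μ (ball x r)) := by rw [hL, one_div]; ring
    exact (ENNReal.mul_le_mul_iff_right hL0 hLtop).1 h8
  calc μ E ≤ μ F := hEF
    _ ≤ μ (⋃ z : u, F ∩ ball (z : M) (5 * ρ z)) := by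
        refine measure_mono fun y hy => ?_
        obtain ⟨z, hz, hyz⟩ := Set.mem_iUnion₂.1 (hcov hy)
        exact Set.mem_iUnion.2 ⟨⟨z, hz⟩, hy, hyz⟩
    _ ≤ ∑' z : u, (1 / 2) ^ n * μ (ball (z : M) (5 * ρ z)) :=
        (measure_iUnion_le _).trans (ENNReal.tsum_le_tsum hpart)
    _ ≤ (1 / 2) ^ n * (1 / 2 * μ (ball x r)) := by
        rw [ENNReal.tsum_mul_left]; gcongr
    _ = _ := by rw [pow_succ]; ring

end JohnNirenberg

/-! ### Averages as $L^q$ norms for a normalized measure. -/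

section LpAverages

variable {α 𝕜 : Type*} [MeasurableSpace α] [RCLike 𝕜] {μ : Measure α} {s : Set α} {f : α → 𝕜}
  {q : ℝ}

theorem rpow_laverage_eq_eLpNorm' (f : α → 𝕜) (q : ℝ) (s : Set α) :
    (⨍⁻ y in s, ‖f y‖ₑ ^ q ∂μ) ^ (1 / q) =
      eLpNorm' f q ((μ.restrict s Set.univ)⁻¹ • μ.restrict s) := rfl

theorem rpow_laverage_le_iff (h0 : μ s ≠ 0) (htop : μ s ≠ ∞) (hq : 0 < q) {g : α → ℝ≥0∞}
    {A : ℝ≥0∞} : (⨍⁻ y in s, g y ∂μ) ^ (1 / q) ≤ A ↔ ∫⁻ y in s, g y ∂μ ≤ A ^ q * μ s := by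
  rw [one_div, ENNReal.rpow_inv_le_iff hq, setLAverage_eq, ENNReal.div_le_iff h0 htop]

theorem rpow_laverage_mono_exponent (h0 : μ s ≠ 0) (htop : μ s ≠ ∞) (hq : 1 ≤ q)
    (hf : AEStronglyMeasurable f μ) :
    (⨍⁻ y in s, ‖f y‖ₑ ^ (1 : ℝ) ∂μ) ^ (1 / (1 : ℝ)) ≤
      (⨍⁻ y in s, ‖f y‖ₑ ^ q ∂μ) ^ (1 / q) := by
  have := isProbabilityMeasure_normalized_restrict h0 htop
  exact eLpNorm'_le_eLpNorm'_of_exponent_le one_pos hq _ (hf.restrict.smul_measure _)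

theorem enorm_setAverage_le_rpow_laverage (h0 : μ s ≠ 0) (htop : μ s ≠ ∞) (hq : 1 ≤ q)
    (hf : AEStronglyMeasurable f μ) :
    ‖⨍ y in s, f y ∂μ‖ₑ ≤ (⨍⁻ y in s, ‖f y‖ₑ ^ q ∂μ) ^ (1 / q) := by
  refine le_trans ?_ (rpow_laverage_mono_exponent h0 htop hq hf)
  simp only [ENNReal.rpow_one, div_one]
  exact enorm_integral_le_lintegral_enorm _

theorem rpow_laverage_sub_average_le (h0 : μ s ≠ 0) (htop : μ s ≠ ∞) (hq : 1 ≤ q)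
    (hf : AEStronglyMeasurable f μ) :
    (⨍⁻ y in s, ‖f y - ⨍ z in s, f z ∂μ‖ₑ ^ q ∂μ) ^ (1 / q) ≤
      2 * (⨍⁻ y in s, ‖f y‖ₑ ^ q ∂μ) ^ (1 / q) := by
  have := isProbabilityMeasure_normalized_restrict h0 htop
  have h1 := enorm_setAverage_le_rpow_laverage h0 htop hq hf
  set k := ⨍ z in s, f z ∂μ
  have h2 := eLpNorm'_add_le (μ := (μ.restrict s Set.univ)⁻¹ • μ.restrict s)
    (f := f) (g := fun _ => -k)
    (hf.restrict.smul_measure (μ.restrict s Set.univ)⁻¹) aestronglyMeasurable_const hq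
  rw [eLpNorm'_const_of_isProbabilityMeasure _ (one_pos.trans_le hq), enorm_neg] at h2
  rw [rpow_laverage_eq_eLpNorm'] at h1
  rw [rpow_laverage_eq_eLpNorm' (fun y => f y - k), rpow_laverage_eq_eLpNorm' f, two_mul]
  simp only [sub_eq_add_neg]
  exact h2.trans (by gcongr)

theorem rpow_laverage_le_add (h0 : μ s ≠ 0) (htop : μ s ≠ ∞) (hq : 1 ≤ q)
    (hf : AEStronglyMeasurable f μ) :
    (⨍⁻ y in s, ‖f y‖ₑ ^ q ∂μ) ^ (1 / q) ≤
      (⨍⁻ y in s, ‖f y - ⨍ z in s, f z ∂μ‖ₑ ^ q ∂μ) ^ (1 / q) +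
        (⨍⁻ y in s, ‖f y‖ₑ ^ (1 : ℝ) ∂μ) ^ (1 / (1 : ℝ)) := by
  have := isProbabilityMeasure_normalized_restrict h0 htop
  have h1 := enorm_setAverage_le_rpow_laverage h0 htop le_rfl hf
  set k := ⨍ z in s, f z ∂μ
  have h2 := eLpNorm'_add_le (μ := (μ.restrict s Set.univ)⁻¹ • μ.restrict s)
    (f := fun y => f y - k) (g := fun _ => k)
    ((hf.sub aestronglyMeasurable_const).restrict.smul_measure (μ.restrict s Set.univ)⁻¹)
    aestronglyMeasurable_const hq
  rw [eLpNorm'_const_of_isProbabilityMeasure _ (one_pos.trans_le hq)] at h2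
  have h3 : (fun y => f y - k) + (fun _ => k) = f := by ext y; simp
  rw [h3] at h2
  exact h2.trans (by gcongr; rfl)

end LpAverages

/-! ### Comparison of the norms. -/

section Comparison

variable {M : Type*} [MetricSpace M] [MeasurableSpace M] {μ : Measure M}

/-- The norm of `𝔟𝔪𝔬^q_b` is bounded by a multiple of the norm of `𝔟𝔪𝔬^p_c`. -/
def GbmoNormLE (𝕜 : Type*) [RCLike 𝕜] (μ : Measure M) (q b p c : ℝ) : Prop :=
  ∃ C : ℝ≥0, 1 ≤ C ∧ ∀ f : M → 𝕜, LocallyIntegrable f μ →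
    gbmoNorm μ q b f ≤ C * gbmoNorm μ p c f

variable {𝕜 : Type*} [RCLike 𝕜] {q b p c : ℝ}

theorem GbmoNormLE.trans {o d : ℝ} (h₁ : GbmoNormLE 𝕜 μ q b p c) (h₂ : GbmoNormLE 𝕜 μ p c o d) :
    GbmoNormLE 𝕜 μ q b o d := by
  obtain ⟨C₁, hC₁, h₁⟩ := h₁
  obtain ⟨C₂, hC₂, h₂⟩ := h₂
  refine ⟨C₁ * C₂, one_le_mul_of_one_le_of_one_le hC₁ hC₂, fun f hf => ?_⟩
  calc gbmoNorm μ q b f ≤ C₁ * (C₂ * gbmoNorm μ o d f) := (h₁ f hf).trans (by gcongr; exact h₂ f hf)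
    _ = _ := by push_cast; ring

/-- The inequalities also cover infinite norms, so finiteness passes both ways. -/
theorem GbmoNormLE.coincide (h₁ : GbmoNormLE 𝕜 μ q b p c) (h₂ : GbmoNormLE 𝕜 μ p c q b) :
    GbmoCoincide 𝕜 μ q b p c := by
  obtain ⟨C₁, hC₁, h₁⟩ := h₁
  obtain ⟨C₂, hC₂, h₂⟩ := h₂
  have hC₁0 : C₁ ≠ 0 := (one_pos.trans_le hC₁).ne'
  refine ⟨Set.ext fun f => and_congr_right fun hf => ⟨fun h => ?_, fun h => ?_⟩,
    C₁⁻¹, C₂, by positivity, one_pos.trans_le hC₂, fun f hf => ⟨?_, h₂ f hf.1⟩⟩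
  · exact (h₂ f hf).trans_lt (ENNReal.mul_lt_top ENNReal.coe_lt_top h)
  · exact (h₁ f hf).trans_lt (ENNReal.mul_lt_top ENNReal.coe_lt_top h)
  · rw [ENNReal.coe_inv hC₁0, mul_comm, ← div_eq_mul_inv]
    exact ENNReal.div_le_of_le_mul' (h₁ f hf.1)

theorem ae_modifiedLocalSharp_le_gbmoNorm (f : M → 𝕜) :
    ∀ᵐ x ∂μ, modifiedLocalSharp μ q b f x ≤ gbmoNorm μ q b f :=
  ENNReal.ae_le_essSup _

theorem rpow_laverage_sub_average_le_modifiedLocalSharp (f : M → 𝕜) (x : M) {r : ℝ}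
    (hr : 0 < r) (hrb : r ≤ b) :
    (⨍⁻ y in ball x r, ‖f y - ⨍ z in ball x r, f z ∂μ‖ₑ ^ q ∂μ) ^ (1 / q) ≤
      modifiedLocalSharp μ q b f x :=
  (le_iSup₂ (f := fun r (_ : r ∈ Set.Ioc (0 : ℝ) b) =>
    (⨍⁻ y in ball x r, ‖f y - ⨍ z in ball x r, f z ∂μ‖ₑ ^ q ∂μ) ^ (1 / q)) r ⟨hr, hrb⟩).trans
    le_self_add

theorem gbmoNormLE_one_exponent [SecondCountableTopology M]
    (hpos : ∀ (x : M) (r : ℝ), 0 < r → 0 < μ (ball x r))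
    (hfin : ∀ (x : M) (r : ℝ), μ (ball x r) < ∞) (hq : 1 ≤ q) (hb : 0 < b) :
    GbmoNormLE 𝕜 μ 1 b q b := by
  refine ⟨1, le_rfl, fun f hf => ?_⟩
  have hfm := hf.aestronglyMeasurable
  rw [ENNReal.coe_one, one_mul]
  refine essSup_mono_ae (Eventually.of_forall fun x => add_le_add ?_ ?_)
  · exact iSup₂_mono fun r hr => rpow_laverage_mono_exponent (hpos x r hr.1).ne' (hfin x r).ne hq
      (hfm.sub aestronglyMeasurable_const)
  · exact rpow_laverage_mono_exponent (hpos x b hb).ne' (hfin x b).ne hq hfm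

variable [BorelSpace M]

theorem LocalDoublingProperty.gbmoNormLE_radius [SigmaFinite μ] [SecondCountableTopology M]
    (hD : LocalDoublingProperty μ) (hpos : ∀ (x : M) (r : ℝ), 0 < r → 0 < μ (ball x r))
    (hfin : ∀ (x : M) (r : ℝ), μ (ball x r) < ∞) (hq : 1 ≤ q) (hb : 0 < b) (hc : 0 < c) :
    GbmoNormLE 𝕜 μ q b q c := by
  have hq0 : 0 < q := one_pos.trans_le hq
  -- The lower bound `min b c` covers both the radius `b` itself and the radii in $[c,b]$.
  obtain ⟨C, hC1, hC⟩ := hD.exists_setLIntegral_ball_le hpos (lt_min hb hc) hc (b := b)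
  refine ⟨1 + 3 * C ^ (1 / q), le_self_add, fun f hf => ?_⟩
  set a := gbmoNorm μ q c f
  have hfm := hf.aestronglyMeasurable
  have hball : ∀ (x : M) (r : ℝ), min b c ≤ r → r ≤ b →
      (⨍⁻ y in ball x r, ‖f y‖ₑ ^ q ∂μ) ^ (1 / q) ≤ (C : ℝ≥0∞) ^ (1 / q) * a := by
    intro x r hmr hrb
    rw [rpow_laverage_le_iff (hpos x r ((lt_min hb hc).trans_le hmr)).ne' (hfin x r).ne hq0,
      ENNReal.mul_rpow_of_nonneg _ _ hq0.le, ← ENNReal.rpow_mul, one_div_mul_cancel hq0.ne',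
      ENNReal.rpow_one]
    refine hC (fun y => ‖f y‖ₑ ^ q) (a ^ q) ?_ x r hmr hrb
    filter_upwards [ae_modifiedLocalSharp_le_gbmoNorm f] with z hz
    exact (rpow_laverage_le_iff (hpos z c hc).ne' (hfin z c).ne hq0).1 (le_add_self.trans hz)
  refine essSup_le_of_ae_le _ ?_
  filter_upwards [ae_modifiedLocalSharp_le_gbmoNorm (q := q) (b := c) (μ := μ) f] with x hx
  have hsharp : localSharp μ q b f x ≤ a + 2 * ((C : ℝ≥0∞) ^ (1 / q) * a) := by
    refine iSup₂_le fun r hr => ?_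
    rcases le_total r c with hrc | hcr
    · exact ((rpow_laverage_sub_average_le_modifiedLocalSharp f x hr.1 hrc).trans hx).trans
        le_self_add
    · refine le_trans ?_ le_add_self
      refine (rpow_laverage_sub_average_le (hpos x r hr.1).ne' (hfin x r).ne hq hfm).trans ?_
      gcongr
      exact hball x r ((min_le_right _ _).trans hcr) hr.2
  calc modifiedLocalSharp μ q b f x
      ≤ (a + 2 * ((C : ℝ≥0∞) ^ (1 / q) * a)) + (C : ℝ≥0∞) ^ (1 / q) * a :=
        add_le_add hsharp (hball x b (min_le_left _ _) le_rfl)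
    _ = _ := by
        push_cast [ENNReal.coe_rpow_of_nonneg C (by positivity : 0 ≤ 1 / q)]
        ring

theorem LocalDoublingProperty.gbmoNormLE_exponent [SigmaFinite μ] [SecondCountableTopology M]
    [IsLocallyFiniteMeasure μ] (hLDP : LocalDoublingProperty μ)
    (hpos : ∀ (x : M) (r : ℝ), 0 < r → 0 < μ (ball x r))
    (hfin : ∀ (x : M) (r : ℝ), μ (ball x r) < ∞) (hq : 1 ≤ q) :
    GbmoNormLE 𝕜 μ q 1 1 1 := by
  have hq0 : 0 < q := one_pos.trans_le hq
  -- John–Nirenberg needs oscillations up to radius `2`; recentring at a good point doubles this to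
  -- `4`.
  obtain ⟨C, hC1, hC⟩ := hLDP.gbmoNormLE_radius (𝕜 := 𝕜) hpos hfin le_rfl four_pos one_pos
  obtain ⟨D, hD1, hD⟩ := hLDP.exists_ball_mul_le two_pos 3
  obtain ⟨K, hK, hJN⟩ := hLDP.exists_john_nirenberg (𝕜 := 𝕜) hpos hfin
  lift ∑' n : ℕ, (((n + 1 : ℕ) : ℝ≥0∞) * K) ^ q * (1 / 2) ^ n to ℝ≥0
    using tsum_rpow_mul_half_pow_ne_top K hq0.le with S hS
  set B : ℝ≥0 := 2 * (S ^ (1 / q) * (2 * D)) + 1 with hB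
  refine ⟨B * C, one_le_mul_of_one_le_of_one_le le_add_self hC1, fun f hf => ?_⟩
  have hfm := hf.aestronglyMeasurable
  -- John–Nirenberg needs a finite positive bound `a`; approaching the norm from above treats norms
  -- `0` and `∞` uniformly.
  suffices key : ∀ a : ℝ≥0, C * gbmoNorm μ 1 1 f < a → gbmoNorm μ q 1 f ≤ B * a by
    by_contra! hcon
    have hB0 : (B : ℝ≥0∞) ≠ 0 := by positivity
    rw [ENNReal.coe_mul, mul_assoc, mul_comm,
      ← ENNReal.lt_div_iff_mul_lt (Or.inl hB0) (Or.inl ENNReal.coe_ne_top)] at hcon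
    obtain ⟨a, ha, haX⟩ := ENNReal.lt_iff_exists_nnreal_btwn.1 hcon
    rw [ENNReal.lt_div_iff_mul_lt (Or.inl hB0) (Or.inl ENNReal.coe_ne_top), mul_comm] at haX
    exact haX.not_ge (key a ha)
  intro a ha
  have ha0 : 0 < a := ENNReal.coe_pos.1 (pos_of_gt ha)
  have h4 : ∀ᵐ x ∂μ, modifiedLocalSharp μ 1 4 f x ≤ a := by
    filter_upwards [ae_modifiedLocalSharp_le_gbmoNorm f] with x hx
    exact (hx.trans (hC f hf)).trans ha.le
  -- Balls need not be relatively compact, so integrability on them comes from the norm bound, not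
  -- from local integrability.
  have hint : ∀ (x : M) (r : ℝ), IntegrableOn f (ball x r) μ := by
    intro x r
    obtain ⟨C', -, h'⟩ := hLDP.exists_setLIntegral_ball_le hpos
      (lt_max_of_lt_right one_pos : 0 < max r 1) four_pos (b := max r 1)
    refine IntegrableOn.mono_set ⟨hfm.restrict, ?_⟩ (ball_subset_ball (le_max_left r 1))
    refine (h' (fun y => ‖f y‖ₑ) a ?_ x _ le_rfl le_rfl).trans_lt
      (ENNReal.mul_lt_top (by finiteness) (hfin _ _))
    filter_upwards [h4] with z hz
    have := (rpow_laverage_le_iff (hpos z 4 four_pos).ne' (hfin z 4).ne one_pos).1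
      (le_add_self.trans hz)
    simpa using this
  have hosc : ∀ (x : M) (r : ℝ), 0 < r → r ≤ 2 →
      ∫⁻ y in ball x r, ‖f y - ⨍ z in ball x r, f z ∂μ‖ₑ ∂μ ≤
        ((2 * D * a : ℝ≥0) : ℝ≥0∞) * μ (ball x r) := by
    intro x r hr hr2
    -- The essential supremum controls only almost every centre, but a ball of positive measure
    -- contains a good one.
    obtain ⟨z, hzx, hz⟩ : ∃ z ∈ ball x r, modifiedLocalSharp μ 1 4 f z ≤ a := by
      by_contra! hcon
      refine (hpos x r hr).ne' (measure_mono_null (fun z hz => ?_) (ae_iff.1 h4))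
      exact (hcon z hz).not_ge
    rw [mem_ball] at hzx
    set k := ⨍ w in ball z (2 * r), f w ∂μ
    have h2r : 0 < 2 * r := by positivity
    have h1 : ∫⁻ y in ball z (2 * r), ‖f y - k‖ₑ ∂μ ≤ a * μ (ball z (2 * r)) := by
      have := (rpow_laverage_le_iff (hpos z _ h2r).ne' (hfin z _).ne one_pos).1
        ((rpow_laverage_sub_average_le_modifiedLocalSharp f z h2r (by linarith)).trans hz)
      simpa using this
    have h2 : ∫⁻ y in ball x r, ‖f y - k‖ₑ ∂μ ≤ (D * a) * μ (ball x r) := by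
      calc ∫⁻ y in ball x r, ‖f y - k‖ₑ ∂μ ≤ ∫⁻ y in ball z (2 * r), ‖f y - k‖ₑ ∂μ :=
            lintegral_mono_set (ball_subset_ball' (by rw [dist_comm]; linarith))
        _ ≤ a * μ (ball x (3 * r)) := h1.trans (by
            gcongr; exact ball_subset_ball' (by linarith))
        _ ≤ a * (D * μ (ball x r)) := by gcongr; exact hD x r hr hr2
        _ = _ := by ring
    refine (setLIntegral_sub_setAverage_le (hpos x r hr).ne' (hfin x r).ne (hint x r) h2).trans
      (le_of_eq ?_)
    push_cast; ring
  have hD0 : 0 < D := one_pos.trans_le hD1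
  have hmoment : ∀ (x : M) (r : ℝ), 0 < r → r ≤ 1 →
      (⨍⁻ y in ball x r, ‖f y - ⨍ z in ball x r, f z ∂μ‖ₑ ^ q ∂μ) ^ (1 / q) ≤
        (S ^ (1 / q) * (2 * D * a) : ℝ≥0) := by
    intro x r hr hr1
    rw [rpow_laverage_le_iff (hpos x r hr).ne' (hfin x r).ne hq0]
    refine (setLIntegral_rpow_le_of_distribution
      (hfm.sub aestronglyMeasurable_const).restrict.enorm (fun y => enorm_ne_top) hK
      (by positivity : 0 < 2 * D * a) hq0
      fun n => hJN f hint (2 * D * a) (by positivity) hosc n x r hr hr1).trans (le_of_eq ?_)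
    rw [← hS, ENNReal.coe_mul (S ^ (1 / q)), ENNReal.mul_rpow_of_nonneg _ _ hq0.le,
      ENNReal.coe_rpow_of_nonneg S (by positivity : 0 ≤ 1 / q), ← ENNReal.rpow_mul,
      one_div_mul_cancel hq0.ne', ENNReal.rpow_one]
  refine essSup_le_of_ae_le _ ?_
  filter_upwards [ae_modifiedLocalSharp_le_gbmoNorm (q := 1) (b := 1) (μ := μ) f] with x hx
  have ha1 : gbmoNorm μ 1 1 f ≤ a := by
    refine le_trans ?_ ha.le
    exact le_mul_of_one_le_left zero_le (by exact_mod_cast hC1)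
  have hx1 : (⨍⁻ y in ball x 1, ‖f y‖ₑ ^ (1 : ℝ) ∂μ) ^ (1 / (1 : ℝ)) ≤ a :=
    (le_add_self.trans hx).trans ha1
  have hsharp : localSharp μ q 1 f x ≤ (S ^ (1 / q) * (2 * D * a) : ℝ≥0) :=
    iSup₂_le fun r hr => hmoment x r hr.1 hr.2
  have hlast := rpow_laverage_le_add (hpos x 1 one_pos).ne' (hfin x 1).ne hq hfm
  calc modifiedLocalSharp μ q 1 f x
      ≤ (S ^ (1 / q) * (2 * D * a) : ℝ≥0) + ((S ^ (1 / q) * (2 * D * a) : ℝ≥0) + a) :=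
        add_le_add hsharp (hlast.trans (add_le_add (hmoment x 1 one_pos le_rfl) hx1))
    _ = _ := by rw [hB]; push_cast; ring

end Comparison

theorem proposition4p2 {M : Type*} [MetricSpace M] [MeasurableSpace M] [BorelSpace M]
    (𝕜 : Type*) [RCLike 𝕜] (μ : Measure M)
    (hpos : 0 < μ Set.univ) (hfin : ∀ (x : M) (r : ℝ), μ (ball x r) < ∞)
    (hLDP : LocalDoublingProperty μ) (hAMP : ApproximateMidpointProperty M) :
    (∀ q b c : ℝ, 1 ≤ q → 0 < c → c < b → GbmoCoincide 𝕜 μ q b q c) ∧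
    (∀ q : ℝ, 1 ≤ q → GbmoCoincide 𝕜 μ q 1 1 1) ∧
    (∀ q p b c : ℝ, 1 ≤ q → 1 ≤ p → 0 < b → 0 < c → GbmoCoincide 𝕜 μ q b p c) := by
  have hball : ∀ (x : M) (r : ℝ), 0 < r → 0 < μ (ball x r) :=
    fun x r hr => hLDP.measure_ball_pos hpos x hr
  have := sigmaFinite_of_measure_ball_lt_top hfin
  have := secondCountableTopology_of_measure_ball_pos hball
  have : IsLocallyFiniteMeasure μ := ⟨fun x => ⟨ball x 1, ball_mem_nhds x one_pos, hfin x 1⟩⟩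
  have hle : ∀ q p b c : ℝ, 1 ≤ q → 1 ≤ p → 0 < b → 0 < c → GbmoNormLE 𝕜 μ q b p c :=
    fun q p b c hq hp hb hc =>
      ((hLDP.gbmoNormLE_radius hball hfin hq hb one_pos).trans
        (hLDP.gbmoNormLE_exponent hball hfin hq)).trans
      ((gbmoNormLE_one_exponent hball hfin hp one_pos).trans
        (hLDP.gbmoNormLE_radius hball hfin hp one_pos hc))
  have hco : ∀ q p b c : ℝ, 1 ≤ q → 1 ≤ p → 0 < b → 0 < c → GbmoCoincide 𝕜 μ q b p c :=
    fun q p b c hq hp hb hc => (hle q p b c hq hp hb hc).coincide (hle p q c b hp hq hc hb)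
  exact ⟨fun q b c hq hc hcb => hco q q b c hq hq (hc.trans hcb) hc,
    fun q hq => hco q 1 1 1 hq le_rfl one_pos one_pos, hco⟩
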